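/- Let $X$ be a sequentially complete Hausdorff locally convex space over $\mathbb{C}$, and let $(T(t))_{t\ge 0}$ be a family of continuous linear operators on $X$ with $T(0)=\mathrm{id}$ and $T(t+s)=T(t)T(s)$ for all $t,s\ge 0$. Assume that it is strongly continuous ($t\mapsto T(t)x$ is continuous on $[0,\infty)$ for every $x\in X$) and locally equicontinuous (for every continuous seminorm $q$ on $X$ and every $t_0\ge 0$ there are a continuous seminorm $p$ on $X$ and $C\ge 0$ with $q(T(t)x)\le C\,p(x)$ for all $t\in[0,t_0]$ and $x\in X$). Let $(A,D(A))$ be its generator, that is, $D(A)$ is the set of all $x\in X$ for which $Ax:=\lim_{t\to 0+}\frac{T(t)x-x}{t}$ exists in $X$. For a linear operator $(B,D(B))$ on $X$ let $\sigma_p(B)$ be the set of all $\lambda\in\mathbb{C}$ such that $\lambda-B\colon D(B)\to X$ is not injective. Then $$\sigma_p(T(t))\setminus\{0\}=e^{t\sigma_p(A)}:=\{e^{t\mu} : \mu\in\sigma_p(A)\}$$ for all $t>0$. The equality also holds for $t=0$, provided that $\sigma_p(A)\neq\varnothing$ or $X=\{0\}$. -/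

import Mathlib

open Filter Topology
open scoped NNReal

namespace LCSemigroup

/-- Every Cauchy sequence converges. -/
def SequentiallyComplete (X : Type*) [UniformSpace X] : Prop :=
  ∀ u : ℕ → X, CauchySeq u → ∃ x : X, Tendsto u atTop (𝓝 x)

section Semigroup

variable {X : Type*} [AddCommGroup X] [Module ℂ X] [TopologicalSpace X]

/-- The semigroup law for a family `(T(t))_{t ≥ 0}` of continuous linear operators. -/
structure IsSemigroup (T : ℝ≥0 → X →L[ℂ] X) : Prop where
  map_zero : T 0 = ContinuousLinearMap.id ℂ X
  map_add : ∀ t s : ℝ≥0, T (t + s) = (T t).comp (T s)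

/-- Continuity of `t ↦ T(t)` for the topology of pointwise convergence on the operators. -/
def StronglyContinuous (T : ℝ≥0 → X →L[ℂ] X) : Prop :=
  ∀ x : X, Continuous fun t : ℝ≥0 => T t x

/-- Local equicontinuity, with respect to the fundamental system of all continuous seminorms. -/
def LocallyEquicontinuous (T : ℝ≥0 → X →L[ℂ] X) : Prop :=
  ∀ q : Seminorm ℂ X, Continuous q → ∀ t₀ : ℝ≥0,
    ∃ p : Seminorm ℂ X, Continuous p ∧ ∃ C : ℝ, 0 ≤ C ∧
      ∀ t : ℝ≥0, t ≤ t₀ → ∀ x : X, q (T t x) ≤ C * p x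

/-- `(T(t)x - x) / t → y` as `t → 0+`. -/
def HasGeneratorValue (T : ℝ≥0 → X →L[ℂ] X) (x y : X) : Prop :=
  Tendsto (fun t : ℝ≥0 => ((t : ℝ) : ℂ)⁻¹ • (T t x - x)) (𝓝[>] 0) (𝓝 y)

theorem HasGeneratorValue.unique [T2Space X] {T : ℝ≥0 → X →L[ℂ] X} {x y z : X}
    (hy : HasGeneratorValue T x y) (hz : HasGeneratorValue T x z) : y = z :=
  tendsto_nhds_unique hy hz

theorem HasGeneratorValue.zero (T : ℝ≥0 → X →L[ℂ] X) : HasGeneratorValue T 0 0 := by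
  simpa [HasGeneratorValue] using tendsto_const_nhds

theorem HasGeneratorValue.add [ContinuousAdd X] {T : ℝ≥0 → X →L[ℂ] X} {x x' y y' : X}
    (h : HasGeneratorValue T x y) (h' : HasGeneratorValue T x' y') :
    HasGeneratorValue T (x + x') (y + y') := by
  refine (Tendsto.add h h').congr fun t => ?_
  rw [← smul_add, map_add]
  congr 1
  abel

theorem HasGeneratorValue.smul [ContinuousConstSMul ℂ X] {T : ℝ≥0 → X →L[ℂ] X} {x y : X}
    (c : ℂ) (h : HasGeneratorValue T x y) : HasGeneratorValue T (c • x) (c • y) := by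
  refine (Tendsto.const_smul h c).congr fun t => ?_
  rw [smul_comm, smul_sub, map_smul]

/-- The generator `(A, D(A))`: `D(A)` is the set of all `x` for which `(T(t)x - x) / t` has a limit
as `t → 0+`, and `Ax` is that limit. -/
noncomputable def generator [T2Space X] [ContinuousAdd X] [ContinuousConstSMul ℂ X]
    (T : ℝ≥0 → X →L[ℂ] X) : X →ₗ.[ℂ] X where
  domain :=
    { carrier := {x | ∃ y, HasGeneratorValue T x y}
      zero_mem' := ⟨0, HasGeneratorValue.zero T⟩
      add_mem' := fun ⟨y, hy⟩ ⟨z, hz⟩ => ⟨y + z, hy.add hz⟩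
      smul_mem' := fun c _ ⟨y, hy⟩ => ⟨c • y, hy.smul c⟩ }
  toFun :=
    { toFun := fun x => Classical.choose x.2
      map_add' := fun x y =>
        (Classical.choose_spec (x + y).2).unique
          ((Classical.choose_spec x.2).add (Classical.choose_spec y.2))
      map_smul' := fun c x =>
        (Classical.choose_spec (c • x).2).unique ((Classical.choose_spec x.2).smul c) }

end Semigroup

/-- The point spectrum of a linear operator `(A, D(A))`: all `μ` such that `μ - A` is not injective
on `D(A)`. -/
def pointSpectrum {X : Type*} [AddCommGroup X] [Module ℂ X] (A : X →ₗ.[ℂ] X) : Set ℂ :=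
  {μ | ¬ Function.Injective fun x : A.domain => μ • (x : X) - A x}

/-- A continuous linear operator on `X`, as a linear operator with domain `X`. -/
def everywhereDefined {X : Type*} [AddCommGroup X] [Module ℂ X] [TopologicalSpace X]
    (S : X →L[ℂ] X) : X →ₗ.[ℂ] X :=
  (S : X →ₗ[ℂ] X).toPMap ⊤

end LCSemigroup

namespace LCSemigroup

/-! Eigenvectors of the generator for `μ` are exactly the `x` with `T s x = exp (s * μ) • x` for all
`s` (`hasGeneratorValue_smul_iff`); this gives one inclusion. Conversely, if `T t x = exp (t * ν) •
x` with `x ≠ 0`, then `s ↦ exp (-(s * ν)) • T s x` is `t`-periodic. Its `n`-th Fourier coefficient,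
if nonzero, is a common eigenvector for `ν + 2πin/t` (`eq_exp_smul_of_weak_integral`). Some
coefficient is nonzero, since otherwise every functional would kill the value `x` at `0`
(`eq_zero_of_fourier_integrals_eq_zero`). The coefficients exist as weak integrals: Riemann sums are
Cauchy and `X` is sequentially complete. Identities are tested on functionals, which separate points
by Hahn–Banach. -/

theorem exists_dual_ne_zero {X : Type*} [AddCommGroup X] [Module ℂ X] [TopologicalSpace X]
    [IsTopologicalAddGroup X] [ContinuousSMul ℂ X] [LocallyConvexSpace ℝ X] [T2Space X]
    {x : X} (hx : x ≠ 0) : ∃ φ : X →L[ℂ] ℂ, φ x ≠ 0 := by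
  obtain ⟨φ, hφ⟩ := RCLike.geometric_hahn_banach_point_point (𝕜 := ℂ) hx
  refine ⟨φ, fun h => ?_⟩
  simp [h] at hφ

theorem eq_of_forall_dual_eq {X : Type*} [AddCommGroup X] [Module ℂ X] [TopologicalSpace X]
    [IsTopologicalAddGroup X] [ContinuousSMul ℂ X] [LocallyConvexSpace ℝ X] [T2Space X]
    {x y : X} (h : ∀ φ : X →L[ℂ] ℂ, φ x = φ y) : x = y := by
  by_contra hxy
  obtain ⟨φ, hφ⟩ := exists_dual_ne_zero (sub_ne_zero.2 hxy)
  exact hφ (by rw [map_sub, h, sub_self])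

/-! ### Riemann sums and weak integrals -/

section RiemannSum

/-- The left Riemann sum of `v` over `[0, 1]` for the partition into `n` equal parts. -/
noncomputable def riemannSum {E : Type*} [AddCommGroup E] [Module ℝ E] (v : ℝ → E) (n : ℕ) : E :=
  (n : ℝ)⁻¹ • ∑ k ∈ Finset.range n, v (k / n)

theorem sum_range_mul_div {E : Type*} [AddCommMonoid E] (f : ℕ → E) (n : ℕ) {m : ℕ} (hm : 0 < m) :
    ∑ j ∈ Finset.range (n * m), f (j / m) = m • ∑ k ∈ Finset.range n, f k := by
  induction n with
  | zero => simp
  | succ n ih =>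
    rw [add_mul, one_mul, Finset.sum_range_add, ih, Finset.sum_range_succ, smul_add]
    congr 1
    rw [Finset.sum_congr rfl (g := fun _ => f n), Finset.sum_const, Finset.card_range]
    intro j hj
    rw [mul_comm, Nat.mul_add_div hm, Nat.div_eq_of_lt (Finset.mem_range.1 hj), add_zero]

variable {E : Type*} [AddCommGroup E] [Module ℝ E]

theorem riemannSum_eq_refinement (v : ℝ → E) (n : ℕ) {m : ℕ} (hm : 0 < m) :
    riemannSum v n =
      ((n * m : ℕ) : ℝ)⁻¹ • ∑ j ∈ Finset.range (n * m), v ((j / m : ℕ) / n) := by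
  have hm' : (m : ℝ) ≠ 0 := by positivity
  rw [sum_range_mul_div (fun k => v (k / n)) n hm, riemannSum, ← Nat.cast_smul_eq_nsmul ℝ,
    smul_smul]
  congr 1
  push_cast
  field_simp

/-- On the common refinement into `n * m` parts the difference is an average of terms `v a - v b`,
so convexity of `U` suffices once `a` and `b` are `δ`-close. -/
theorem riemannSum_sub_mem {v : ℝ → E} {U : Set E} (hU : Convex ℝ U) {δ : ℝ}
    (h : ∀ a ∈ Set.Icc (0 : ℝ) 1, ∀ b ∈ Set.Icc (0 : ℝ) 1, |a - b| < δ → v a - v b ∈ U)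
    {n m : ℕ} (hn : 0 < n) (hm : 0 < m) (hnδ : (n : ℝ)⁻¹ < δ) (hmδ : (m : ℝ)⁻¹ < δ) :
    riemannSum v n - riemannSum v m ∈ U := by
  have hn' : (0 : ℝ) < n := by positivity
  have hm' : (0 : ℝ) < m := by positivity
  -- The sample point `⌊j / q⌋ / p` lies less than `1 / p` below the fine node `j / (p * q)`; both
  -- sample points are compared with this node.
  have key : ∀ p q j : ℕ, 0 < p → 0 < q → j < p * q →
      ((j / q : ℕ) : ℝ) / p ∈ Set.Icc (0 : ℝ) 1 ∧ ((j / q : ℕ) : ℝ) / p ≤ j / (p * q) ∧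
        (j : ℝ) / (p * q) < ((j / q : ℕ) : ℝ) / p + (p : ℝ)⁻¹ := by
    intro p q j hp hq hj
    have hp' : (0 : ℝ) < p := by positivity
    have hq' : (0 : ℝ) < q := by positivity
    have h1 : ((j / q : ℕ) : ℝ) ≤ j / q := Nat.cast_div_le
    have h2 : (j : ℝ) / q < ((j / q : ℕ) : ℝ) + 1 := by
      rw [div_lt_iff₀ hq']
      exact_mod_cast Nat.lt_mul_of_div_lt (Nat.lt_succ_self _) hq
    have h3 : (j : ℝ) / q ≤ p := by
      rw [div_le_iff₀ hq']
      exact_mod_cast hj.le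
    have h4 : (j : ℝ) / (p * q) = j / q / p := by
      rw [div_div, mul_comm]
    refine ⟨⟨by positivity, (div_le_one hp').2 (h1.trans h3)⟩, ?_, ?_⟩
    · rw [h4]
      gcongr
    · rw [h4, ← one_div, ← add_div]
      gcongr
  rw [riemannSum_eq_refinement v n hm, riemannSum_eq_refinement v m hn, mul_comm m n, ← smul_sub,
    ← Finset.sum_sub_distrib, Finset.smul_sum]
  refine hU.sum_mem (fun _ _ => by positivity) ?_ ?_
  · rw [Finset.sum_const, Finset.card_range, nsmul_eq_mul, mul_inv_cancel₀]
    positivity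
  · intro j hj
    have hj := Finset.mem_range.1 hj
    obtain ⟨a1, a2, a3⟩ := key n m j hn hm hj
    obtain ⟨b1, b2, b3⟩ := key m n j hm hn (by rwa [mul_comm])
    rw [mul_comm (m : ℝ)] at b2 b3
    refine h _ a1 _ b1 (abs_lt.2 ⟨?_, ?_⟩) <;> linarith

theorem cauchySeq_riemannSum {X : Type*} [AddCommGroup X] [Module ℝ X] [UniformSpace X]
    [IsUniformAddGroup X] [LocallyConvexSpace ℝ X] {v : ℝ → X} (hv : Continuous v) :
    CauchySeq (riemannSum v) := by
  have huc : UniformContinuousOn v (Set.Icc 0 1) :=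
    isCompact_Icc.uniformContinuousOn_of_continuous hv.continuousOn
  have hb := (LocallyConvexSpace.convex_basis_zero ℝ X).uniformity_of_nhds_zero_swapped
  refine hb.cauchySeq_iff.2 ?_
  rintro U ⟨hU, hUc⟩
  obtain ⟨δ, hδ, h⟩ := (Metric.uniformity_basis_dist.inf_principal _ |>.tendsto_iff hb).1 huc U
    ⟨hU, hUc⟩
  obtain ⟨N, hN⟩ := exists_nat_gt δ⁻¹
  have hNpos : (0 : ℝ) < N := (inv_pos.2 hδ).trans hN
  have hlt : ∀ n ≥ N, 0 < n ∧ (n : ℝ)⁻¹ < δ := by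
    intro n hn
    have : (N : ℝ) ≤ n := by exact_mod_cast hn
    exact ⟨by exact_mod_cast hNpos.trans_le this, inv_lt_of_inv_lt₀ hδ (hN.trans_le this)⟩
  refine ⟨N, fun m hm n hn => ?_⟩
  refine riemannSum_sub_mem hUc (fun a ha b hb hab => ?_) (hlt m hm).1 (hlt n hn).1 (hlt m hm).2
    (hlt n hn).2
  exact h (a, b) ⟨by simpa [Real.dist_eq] using hab, ⟨ha, hb⟩⟩

theorem tendsto_riemannSum_integral {g : ℝ → ℂ} (hg : Continuous g) :
    Tendsto (riemannSum g) atTop (𝓝 (∫ s in (0 : ℝ)..1, g s)) := by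
  have huc : UniformContinuousOn g (Set.Icc 0 1) :=
    isCompact_Icc.uniformContinuousOn_of_continuous hg.continuousOn
  rw [Metric.tendsto_atTop]
  intro ε hε
  obtain ⟨δ, hδ, h⟩ := Metric.uniformContinuousOn_iff.1 huc (ε / 2) (half_pos hε)
  obtain ⟨N, hN⟩ := exists_nat_gt δ⁻¹
  have hNpos : (0 : ℝ) < N := (inv_pos.2 hδ).trans hN
  refine ⟨N, fun n hn => ?_⟩
  have hNn : (N : ℝ) ≤ n := by exact_mod_cast hn
  have hn0 : (0 : ℝ) < n := hNpos.trans_le hNn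
  have hnδ : (n : ℝ)⁻¹ < δ := inv_lt_of_inv_lt₀ hδ (hN.trans_le hNn)
  have hstep : ∀ k : ℕ, ((k + 1 : ℕ) : ℝ) / n - k / n = (n : ℝ)⁻¹ := by
    intro k
    push_cast
    ring
  have hint : ∫ s in (0 : ℝ)..1, g s =
      ∑ k ∈ Finset.range n, ∫ s in ((k : ℕ) : ℝ) / n..((k + 1 : ℕ) : ℝ) / n, g s := by
    rw [intervalIntegral.sum_integral_adjacent_intervals (a := fun k : ℕ => (k : ℝ) / n)
      (fun k _ => hg.intervalIntegrable _ _)]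
    simp [hn0.ne']
  have hsum : riemannSum g n - ∫ s in (0 : ℝ)..1, g s =
      ∑ k ∈ Finset.range n, ∫ s in ((k : ℕ) : ℝ) / n..((k + 1 : ℕ) : ℝ) / n, (g (k / n) - g s) := by
    rw [hint, riemannSum, Finset.smul_sum, ← Finset.sum_sub_distrib]
    refine Finset.sum_congr rfl fun k _ => ?_
    rw [intervalIntegral.integral_sub (by simp) (hg.intervalIntegrable _ _),
      intervalIntegral.integral_const, hstep]
  rw [dist_eq_norm, hsum]
  calc _ ≤ ∑ k ∈ Finset.range n, (ε / 2) * (n : ℝ)⁻¹ := by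
        refine (norm_sum_le _ _).trans (Finset.sum_le_sum fun k hk => ?_)
        have hk' : ((k + 1 : ℕ) : ℝ) ≤ n := by exact_mod_cast Finset.mem_range.1 hk
        have hs := hstep k
        have hin : (0 : ℝ) < (n : ℝ)⁻¹ := by positivity
        have hk0 : (0 : ℝ) ≤ (k : ℝ) / n := by positivity
        have hk1 : ((k + 1 : ℕ) : ℝ) / n ≤ 1 := (div_le_one hn0).2 hk'
        refine (intervalIntegral.norm_integral_le_of_norm_le_const (C := ε / 2)
          fun s hs' => ?_).trans_eq ?_
        · rw [Set.uIoc_of_le (by linarith)] at hs'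
          rw [← dist_eq_norm]
          refine (h _ ⟨hk0, by linarith⟩ _ ⟨by linarith [hs'.1], by linarith [hs'.2]⟩ ?_).le
          rw [Real.dist_eq, abs_lt]
          constructor <;> linarith [hs'.1, hs'.2]
        · rw [hs, abs_of_pos hin]
    _ = ε / 2 := by
        rw [Finset.sum_const, Finset.card_range, nsmul_eq_mul]
        field_simp
    _ < ε := half_lt_self hε

end RiemannSum

/-- In a sequentially complete locally convex space, continuous functions on `[0, 1]` are
Pettis integrable. -/
theorem SequentiallyComplete.exists_weak_integral {X : Type*} [AddCommGroup X] [Module ℂ X]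
    [UniformSpace X] [IsUniformAddGroup X] [LocallyConvexSpace ℝ X] (hX : SequentiallyComplete X)
    {v : ℝ → X} (hv : Continuous v) :
    ∃ y : X, ∀ φ : X →L[ℂ] ℂ, φ y = ∫ s in (0 : ℝ)..1, φ (v s) := by
  obtain ⟨y, hy⟩ := hX _ (cauchySeq_riemannSum hv)
  refine ⟨y, fun φ => ?_⟩
  refine tendsto_nhds_unique ((φ.continuous.tendsto y).comp hy) ?_
  refine (tendsto_riemannSum_integral (φ.continuous.comp hv)).congr fun n => ?_
  simp [riemannSum, map_sum]

/-- A continuous function on `[0, 1]` with equal boundary values and vanishing Fourier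
coefficients vanishes at `0`. -/
theorem eq_zero_of_fourier_integrals_eq_zero {g : ℝ → ℂ} (hg : Continuous g) (h01 : g 0 = g 1)
    (h : ∀ n : ℤ,
      ∫ s in (0 : ℝ)..1, Complex.exp (-(2 * Real.pi * Complex.I * n * s)) * g s = 0) :
    g 0 = 0 := by
  have : Fact ((0 : ℝ) < 1) := ⟨one_pos⟩
  let F : C(AddCircle (1 : ℝ), ℂ) :=
    ⟨AddCircle.liftIco 1 0 g, AddCircle.liftIco_zero_continuous h01 hg.continuousOn⟩
  have hF : fourierCoeff F = 0 := by
    funext n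
    change fourierCoeff (AddCircle.liftIco 1 0 g) n = 0
    rw [fourierCoeff_liftIco_eq, fourierCoeffOn_eq_integral]
    refine smul_eq_zero_of_right _ ((zero_add (1 : ℝ)).symm ▸ ?_)
    rw [← h n]
    refine intervalIntegral.integral_congr fun s _ => ?_
    simp only [smul_eq_mul, fourier_coe_apply]
    congr 2
    push_cast
    ring
  -- Vanishing coefficients are trivially summable, so the Fourier series converges pointwise to
  -- `F`.
  have hs := has_pointwise_sum_fourier_series_of_summable (f := F)
    (by rw [hF]; exact summable_zero) 0
  have h0 : F 0 = 0 := by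
    simp only [hF, Pi.zero_apply, zero_smul] at hs
    exact hs.unique hasSum_zero
  have h1 : F 0 = g 0 := by
    have := AddCircle.liftIco_coe_apply (p := (1 : ℝ)) (a := 0) (f := g) (x := 0) (by simp)
    rwa [AddCircle.coe_zero] at this
  rw [← h1, h0]

/-! ### Point spectra in terms of eigenvectors -/

section PointSpectrum

theorem mem_pointSpectrum_iff {X : Type*} [AddCommGroup X] [Module ℂ X] {A : X →ₗ.[ℂ] X} {μ : ℂ} :
    μ ∈ pointSpectrum A ↔ ∃ x : A.domain, x ≠ 0 ∧ A x = μ • (x : X) := by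
  have : (fun x : A.domain => μ • (x : X) - A x) = (μ • A.domain.subtype - A.toFun : A.domain →ₗ[ℂ] X) := rfl
  rw [pointSpectrum, Set.mem_ofPred_eq, this, injective_iff_map_eq_zero]
  push Not
  refine exists_congr fun x => ?_
  rw [and_comm, LinearMap.sub_apply, sub_eq_zero, eq_comm (b := A.toFun x)]
  rfl

variable {X : Type*} [AddCommGroup X] [Module ℂ X] [TopologicalSpace X]

theorem mem_pointSpectrum_everywhereDefined_iff {S : X →L[ℂ] X} {μ : ℂ} :
    μ ∈ pointSpectrum (everywhereDefined S) ↔ ∃ x : X, x ≠ 0 ∧ S x = μ • x := by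
  rw [mem_pointSpectrum_iff]
  constructor
  · rintro ⟨x, hx, h⟩
    exact ⟨x, by simpa using hx, h⟩
  · rintro ⟨x, hx, h⟩
    exact ⟨⟨x, Submodule.mem_top⟩, fun h0 => hx (congrArg Subtype.val h0), h⟩

theorem mem_pointSpectrum_generator_iff [T2Space X] [ContinuousAdd X] [ContinuousConstSMul ℂ X]
    {T : ℝ≥0 → X →L[ℂ] X} {μ : ℂ} :
    μ ∈ pointSpectrum (generator T) ↔ ∃ x : X, x ≠ 0 ∧ HasGeneratorValue T x (μ • x) := by
  rw [mem_pointSpectrum_iff]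
  constructor
  · rintro ⟨x, hx, h⟩
    refine ⟨x, by simpa using hx, ?_⟩
    rw [← h]
    exact Classical.choose_spec x.2
  · rintro ⟨x, hx, h⟩
    have hmem : x ∈ (generator T).domain := ⟨_, h⟩
    refine ⟨⟨x, hmem⟩, fun h0 => hx (congrArg Subtype.val h0), ?_⟩
    exact (Classical.choose_spec hmem).unique h

end PointSpectrum

/-! ### Exponential orbits of eigenvectors -/

section Exponential

theorem tendsto_coe_nhdsGT_zero :
    Tendsto (fun t : ℝ≥0 => ((t : ℝ) : ℂ)) (𝓝[>] 0) (𝓝[≠] 0) := by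
  refine tendsto_nhdsWithin_iff.2 ⟨?_, ?_⟩
  · have : Continuous fun t : ℝ≥0 => ((t : ℝ) : ℂ) := by fun_prop
    simpa using (this.tendsto 0).mono_left nhdsWithin_le_nhds
  · filter_upwards [self_mem_nhdsWithin] with t ht
    have : (t : ℝ) ≠ 0 := by exact_mod_cast (Set.mem_Ioi.1 ht).ne'
    simpa using this

variable {X : Type*} [AddCommGroup X] [Module ℂ X] [TopologicalSpace X]

theorem HasGeneratorValue.of_forall_eq_exp_smul [ContinuousSMul ℂ X] {T : ℝ≥0 → X →L[ℂ] X} {x : X}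
    {μ : ℂ} (h : ∀ s : ℝ≥0, T s x = Complex.exp ((s : ℝ) * μ) • x) :
    HasGeneratorValue T x (μ • x) := by
  have hd : HasDerivAt (fun z : ℂ => Complex.exp (z * μ)) μ 0 := by
    simpa using ((hasDerivAt_id (0 : ℂ)).mul_const μ).cexp
  have h1 := (hasDerivAt_iff_tendsto_slope_zero.1 hd).comp tendsto_coe_nhdsGT_zero
  refine (h1.smul_const x).congr fun t => ?_
  simp only [Function.comp, zero_add, zero_mul, Complex.exp_zero, smul_eq_mul]
  rw [h, mul_smul, sub_smul, one_smul]

/-- The function `exp (-(r * μ)) * φ (T r x)` is continuous with zero right derivative, hence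
constant. Right derivatives are what the one-sided limit defining the generator provides. -/
theorem HasGeneratorValue.dual_apply_eq_exp_mul {T : ℝ≥0 → X →L[ℂ] X} (hT : IsSemigroup T)
    (hTc : StronglyContinuous T) {x : X} {μ : ℂ} (h : HasGeneratorValue T x (μ • x))
    (φ : X →L[ℂ] ℂ) (s : ℝ≥0) : φ (T s x) = Complex.exp ((s : ℝ) * μ) * φ x := by
  set g : ℝ → ℂ := fun r => φ (T r.toNNReal x) with hg
  have hgc : Continuous g := φ.continuous.comp ((hTc x).comp continuous_real_toNNReal)
  have hgd : ∀ r : ℝ, 0 ≤ r → HasDerivWithinAt g (μ * g r) (Set.Ici r) r := by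
    intro r hr
    have hto : Tendsto (fun z : ℝ => (z - r).toNNReal) (𝓝[>] r) (𝓝[>] 0) := by
      refine tendsto_nhdsWithin_iff.2 ⟨?_, ?_⟩
      · have : Continuous fun z : ℝ => (z - r).toNNReal := by fun_prop
        simpa using (this.tendsto r).mono_left nhdsWithin_le_nhds
      · filter_upwards [self_mem_nhdsWithin] with z hz
        simpa using hz
    -- The semigroup law carries the limit at `0` to `r` by applying `φ ∘ T r`.
    have h1 := ((φ.comp (T r.toNNReal)).continuous.tendsto _).comp (h.comp hto)
    rw [← hasDerivWithinAt_Ioi_iff_Ici, hasDerivWithinAt_iff_tendsto_slope' (by simp)]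
    have h2 : (φ.comp (T r.toNNReal)) (μ • x) = μ * g r := by simp [hg]
    rw [h2] at h1
    refine h1.congr' ?_
    filter_upwards [self_mem_nhdsWithin] with z hz
    have hz : r < z := hz
    have h3 : z.toNNReal = r.toNNReal + (z - r).toNNReal := by
      rw [← Real.toNNReal_add hr (by linarith), add_sub_cancel]
    simp only [Function.comp, hg, slope_def_module, h3, hT.map_add, map_smul, map_sub,
      ContinuousLinearMap.comp_apply, Real.coe_toNNReal _ (sub_nonneg.2 hz.le), smul_eq_mul,
      Complex.real_smul, Complex.ofReal_inv]
  have hed : ∀ r : ℝ, HasDerivAt (fun r : ℝ => Complex.exp (-(r * μ)))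
      (Complex.exp (-(r * μ)) * -μ) r := by
    intro r
    simpa using (((hasDerivAt_id r).ofReal_comp).mul_const μ).neg.cexp
  have hconst := constant_of_has_deriv_right_zero (a := 0) (b := s)
    (f := fun r : ℝ => Complex.exp (-(r * μ)) * g r) (by fun_prop) (fun r hr => by
      have := (hed r).hasDerivWithinAt.mul (hgd r hr.1)
      refine this.congr_deriv ?_
      ring) s ⟨s.2, le_rfl⟩
  simp only [hg, Real.toNNReal_coe, Complex.ofReal_zero, zero_mul, neg_zero, Complex.exp_zero,
    one_mul, Real.toNNReal_zero, hT.map_zero, ContinuousLinearMap.id_apply] at hconst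
  rw [← hconst, ← mul_assoc, ← Complex.exp_add, add_neg_cancel, Complex.exp_zero, one_mul]

/-- The eigenvectors of the generator for `μ` are the common eigenvectors of the operators `T s`
for the eigenvalues `exp (s * μ)`. -/
theorem hasGeneratorValue_smul_iff [IsTopologicalAddGroup X] [ContinuousSMul ℂ X]
    [LocallyConvexSpace ℝ X] [T2Space X] {T : ℝ≥0 → X →L[ℂ] X} (hT : IsSemigroup T)
    (hTc : StronglyContinuous T) {x : X} {μ : ℂ} :
    HasGeneratorValue T x (μ • x) ↔ ∀ s : ℝ≥0, T s x = Complex.exp ((s : ℝ) * μ) • x := by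
  refine ⟨fun h s => eq_of_forall_dual_eq fun φ => ?_, .of_forall_eq_exp_smul⟩
  rw [h.dual_apply_eq_exp_mul hT hTc, map_smul, smul_eq_mul]

end Exponential

/-! ### Twisted orbit averages -/

theorem intervalIntegral_comp_add_right_of_periodic {g : ℝ → ℂ} (hg : Continuous g)
    (hper : ∀ s : ℝ, 0 ≤ s → g (s + 1) = g s) {a : ℝ} (ha : 0 ≤ a) :
    ∫ s in (0 : ℝ)..1, g (s + a) = ∫ s in (0 : ℝ)..1, g s := by
  have hi : ∀ b c : ℝ, IntervalIntegrable g MeasureTheory.volume b c :=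
    fun b c => hg.intervalIntegrable b c
  have h1 : ∫ s in (1 : ℝ)..1 + a, g s = ∫ s in (0 : ℝ)..a, g s := by
    have := intervalIntegral.integral_comp_add_right g (a := 0) (b := a) 1
    rw [zero_add, add_comm a] at this
    rw [← this]
    refine intervalIntegral.integral_congr fun s hs => hper s ?_
    rw [Set.uIcc_of_le ha] at hs
    exact hs.1
  rw [intervalIntegral.integral_comp_add_right, zero_add,
    ← intervalIntegral.integral_interval_sub_left (hi 0 (1 + a)) (hi 0 a),
    ← intervalIntegral.integral_add_adjacent_intervals (hi 0 1) (hi 1 (1 + a)), h1,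
    add_sub_cancel_right]

theorem StronglyContinuous.continuous_exp_smul {X : Type*} [AddCommGroup X] [Module ℂ X]
    [TopologicalSpace X] [ContinuousSMul ℂ X] {T : ℝ≥0 → X →L[ℂ] X} (hTc : StronglyContinuous T)
    (t : ℝ≥0) (μ : ℂ) (x : X) :
    Continuous fun s : ℝ => Complex.exp (-((s * t : ℝ) * μ)) • T (s * t).toNNReal x :=
  Continuous.smul (by fun_prop) ((hTc x).comp (continuous_real_toNNReal.comp (by fun_prop)))

/-- The orbit average of `x` over `[0, t]` twisted by `exp (-sμ)` is a common eigenvector, when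
`T t x = exp (tμ) x`. -/
theorem eq_exp_smul_of_weak_integral {X : Type*} [AddCommGroup X] [Module ℂ X]
    [TopologicalSpace X] [IsTopologicalAddGroup X] [ContinuousSMul ℂ X] [LocallyConvexSpace ℝ X]
    [T2Space X] {T : ℝ≥0 → X →L[ℂ] X} (hT : IsSemigroup T) (hTc : StronglyContinuous T)
    {t : ℝ≥0} (ht : 0 < t) {μ : ℂ} {x y : X} (hx : T t x = Complex.exp ((t : ℝ) * μ) • x)
    (hy : ∀ φ : X →L[ℂ] ℂ,
      φ y = ∫ s in (0 : ℝ)..1, φ (Complex.exp (-((s * t : ℝ) * μ)) • T (s * t).toNNReal x))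
    (h : ℝ≥0) : T h y = Complex.exp ((h : ℝ) * μ) • y := by
  have ht' : (0 : ℝ) < t := by exact_mod_cast ht
  refine eq_of_forall_dual_eq fun φ => ?_
  set g : ℝ → ℂ := fun s => φ (Complex.exp (-((s * t : ℝ) * μ)) • T (s * t).toNNReal x) with hg
  have hgc : Continuous g := φ.continuous.comp (hTc.continuous_exp_smul t μ x)
  have hper : ∀ s : ℝ, 0 ≤ s → g (s + 1) = g s := by
    intro s hs
    have h1 : ((s + 1) * t).toNNReal = (s * t).toNNReal + t := by
      rw [add_mul, one_mul, Real.toNNReal_add (by positivity) t.coe_nonneg, Real.toNNReal_coe]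
    simp only [hg, h1, hT.map_add, ContinuousLinearMap.comp_apply, hx, map_smul, smul_eq_mul]
    rw [← mul_assoc, ← Complex.exp_add]
    congr 2
    push_cast
    ring
  -- Time is rescaled to period `1`, so applying `T h` is a shift by `h / t`, up to the factor `exp
  -- (h * μ)`.
  have hshift := intervalIntegral_comp_add_right_of_periodic hgc hper (a := h / t) (by positivity)
  have h2 := hy (φ.comp (T h))
  rw [ContinuousLinearMap.comp_apply] at h2
  rw [h2, map_smul, hy φ, ← hshift, smul_eq_mul, ← intervalIntegral.integral_const_mul]
  refine intervalIntegral.integral_congr fun s hs => ?_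
  rw [Set.uIcc_of_le zero_le_one] at hs
  have h3 : ((s + h / t) * t).toNNReal = h + (s * t).toNNReal := by
    rw [add_mul, div_mul_cancel₀ _ ht'.ne', add_comm,
      Real.toNNReal_add h.coe_nonneg (mul_nonneg hs.1 ht'.le), Real.toNNReal_coe]
  simp only [hg, h3, hT.map_add, ContinuousLinearMap.comp_apply, map_smul, smul_eq_mul]
  rw [← mul_assoc, ← Complex.exp_add]
  congr 2
  have h4 : (t : ℂ) ≠ 0 := by exact_mod_cast ht'.ne'
  push_cast
  field_simp
  ring

/-- A nonzero eigenvalue of `T t` comes from an eigenvalue of the generator. -/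
theorem exists_eigenvector_of_apply_eq_exp_smul {X : Type*} [AddCommGroup X] [Module ℂ X]
    [UniformSpace X] [IsUniformAddGroup X] [ContinuousSMul ℂ X] [LocallyConvexSpace ℝ X]
    [T2Space X] (hX : SequentiallyComplete X) {T : ℝ≥0 → X →L[ℂ] X} (hT : IsSemigroup T)
    (hTc : StronglyContinuous T) {t : ℝ≥0} (ht : 0 < t) {ν : ℂ} {x : X} (hx0 : x ≠ 0)
    (hx : T t x = Complex.exp ((t : ℝ) * ν) • x) :
    ∃ μ : ℂ, Complex.exp ((t : ℝ) * μ) = Complex.exp ((t : ℝ) * ν) ∧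
      ∃ y : X, y ≠ 0 ∧ ∀ s : ℝ≥0, T s y = Complex.exp ((s : ℝ) * μ) • y := by
  have ht' : ((t : ℝ) : ℂ) ≠ 0 := by exact_mod_cast ht.ne'
  obtain ⟨φ, hφ⟩ := exists_dual_ne_zero hx0
  -- These are all the solutions of `exp (t * μ) = exp (t * ν)`; twisting by `μ n` produces the
  -- `n`-th Fourier coefficient.
  let μ : ℤ → ℂ := fun n => ν + 2 * Real.pi * Complex.I * n / (t : ℝ)
  have hμ : ∀ n, Complex.exp ((t : ℝ) * μ n) = Complex.exp ((t : ℝ) * ν) := by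
    intro n
    have : (t : ℝ) * μ n = (t : ℝ) * ν + n * (2 * Real.pi * Complex.I) := by
      simp only [μ]
      field_simp
    rw [this, Complex.exp_add, Complex.exp_int_mul_two_pi_mul_I, mul_one]
  have hex : ∀ n, ∃ y : X, ∀ ψ : X →L[ℂ] ℂ, ψ y =
      ∫ s in (0 : ℝ)..1, ψ (Complex.exp (-((s * t : ℝ) * μ n)) • T (s * t).toNNReal x) :=
    fun n => hX.exists_weak_integral (hTc.continuous_exp_smul t (μ n) x)
  choose y hy using hex
  suffices ∃ n, y n ≠ 0 by
    obtain ⟨n, hn⟩ := this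
    exact ⟨μ n, hμ n, y n, hn,
      eq_exp_smul_of_weak_integral hT hTc ht (by rw [hμ, hx]) (hy n)⟩
  by_contra! hzero
  refine hφ ?_
  have := eq_zero_of_fourier_integrals_eq_zero
    (g := fun s => φ (Complex.exp (-((s * t : ℝ) * ν)) • T (s * t).toNNReal x))
    (φ.continuous.comp (hTc.continuous_exp_smul t ν x)) ?_ fun n => ?_
  · simpa [hT.map_zero] using this
  · simp [hT.map_zero, hx, ← mul_assoc, ← Complex.exp_add]
  · have h1 := hy n φ
    rw [hzero, map_zero] at h1
    rw [h1]
    refine intervalIntegral.integral_congr fun s _ => ?_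
    simp only [map_smul, smul_eq_mul]
    rw [← mul_assoc, ← Complex.exp_add]
    congr 2
    simp only [μ]
    push_cast
    field_simp
    ring

end LCSemigroup

theorem mainTheorem1 {X : Type*} [AddCommGroup X] [Module ℂ X] [UniformSpace X]
    [IsUniformAddGroup X] [ContinuousSMul ℂ X] [LocallyConvexSpace ℝ X] [T2Space X]
    (hX : LCSemigroup.SequentiallyComplete X)
    (T : ℝ≥0 → X →L[ℂ] X) (hT : LCSemigroup.IsSemigroup T)
    (hTc : LCSemigroup.StronglyContinuous T) (hTe : LCSemigroup.LocallyEquicontinuous T)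
    (t : ℝ≥0)
    (ht : 0 < t ∨ (LCSemigroup.pointSpectrum (LCSemigroup.generator T)).Nonempty ∨
      Subsingleton X) :
    LCSemigroup.pointSpectrum (LCSemigroup.everywhereDefined (T t)) \ {0} =
      (fun μ : ℂ => Complex.exp (((t : ℝ) : ℂ) * μ)) ''
        LCSemigroup.pointSpectrum (LCSemigroup.generator T) := by
  ext z
  simp only [Set.mem_sdiff, Set.mem_singleton_iff, Set.mem_image,
    LCSemigroup.mem_pointSpectrum_everywhereDefined_iff]
  constructor
  · rintro ⟨⟨x, hx0, hx⟩, hz⟩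
    rcases eq_zero_or_pos t with rfl | htpos
    -- For `t = 0` the operator is the identity and `exp (0 * μ) = 1`, so any `μ` in the point
    -- spectrum serves.
    · have hz1 : z = 1 := by
        rw [hT.map_zero, ContinuousLinearMap.id_apply] at hx
        exact (smul_left_injective ℂ hx0 (by simpa using hx)).symm
      rcases ht with ht | ⟨μ, hμ⟩ | hsub
      · exact absurd ht (lt_irrefl 0)
      · exact ⟨μ, hμ, by simp [hz1]⟩
      · exact absurd (Subsingleton.elim x 0) hx0
    · have ht' : ((t : ℝ) : ℂ) ≠ 0 := by exact_mod_cast htpos.ne'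
      have hexp : Complex.exp ((t : ℝ) * (Complex.log z / (t : ℝ))) = z := by
        rw [mul_div_cancel₀ _ ht', Complex.exp_log hz]
      obtain ⟨μ, hμ, y, hy0, hy⟩ := LCSemigroup.exists_eigenvector_of_apply_eq_exp_smul hX hT hTc
        htpos (ν := Complex.log z / (t : ℝ)) hx0 (by rw [hexp, hx])
      exact ⟨μ, LCSemigroup.mem_pointSpectrum_generator_iff.2 ⟨y, hy0, .of_forall_eq_exp_smul hy⟩,
        hμ.trans hexp⟩
  · rintro ⟨μ, hμ, rfl⟩
    obtain ⟨x, hx0, hx⟩ := LCSemigroup.mem_pointSpectrum_generator_iff.1 hμ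
    exact ⟨⟨x, hx0, (LCSemigroup.hasGeneratorValue_smul_iff hT hTc).1 hx t⟩, Complex.exp_ne_zero _⟩
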